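/- Let $K$ be a field (for instance $\mathbb{C}$), let $q,r\in K^{\times}$ with $q^2\neq\pm1$, and put $\delta=\frac{r-r^{-1}}{q-q^{-1}}$; assume $\delta^2\neq 1$. Let $\mathscr{P}^H_{\bullet}(q,r)$ be the HOMFLY-PT planar algebra: its $n$-box space is the $K$-vector space of formal linear combinations of oriented tangle diagrams in a rectangle with $n$ bottom and $n$ top boundary points, of alternating orientation around the boundary, modulo planar isotopy, the oriented Reidemeister moves II and III, the Hecke relation $(\text{positive crossing})-(\text{negative crossing})=(q-q^{-1})\,(\text{two parallel strings})$, the relations that a positive (negative) curl may be removed at the cost of the factor $r$ (respectively $r^{-1}$), and the relations that a closed circle of either orientation may be removed at the cost of the factor $\delta$. Multiplication is vertical stacking, and $tr(x)=t$ means that closing all strings of $x$ around the right gives $t$ times the empty diagram. In the $3$-box space $\mathscr{P}^H(q,r)_{3,+}$ (bottom and top boundary up, down, up) let $e_1,e_2$ be the Temperley-Lieb diagrams consisting of a cap, a cup and one through string, so that $e_i^2=\delta e_i$, and let $$f_3=1-\frac{\delta}{\delta^2-1}(e_1+e_2)+\frac{1}{\delta^2-1}(e_1e_2+e_2e_1)$$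 be the third Jones-Wenzl idempotent. Then there exist two idempotents $P,Q\in\mathscr{P}^H(q,r)_{3,+}$ with $P+Q=f_3$ and $$tr(P)=\frac{(r-r^{-1})(rq-r^{-1}q^{-1})(rq^{-2}-r^{-1}q^{2})}{(q+q^{-1})(q-q^{-1})^3},\qquad tr(Q)=\frac{(r-r^{-1})(rq^{2}-r^{-1}q^{-2})(rq^{-1}-r^{-1}q)}{(q+q^{-1})(q-q^{-1})^3}.$$ -/

import Mathlib

namespace HOMFLY

/-- The two directions in which an oriented strand can meet a horizontal line:
`u` (upwards) and `d` (downwards). A horizontal cross-section of an oriented diagram is a word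
in `u`, `d`. Words are listed **from right to left**: the head of the list is the rightmost
strand, so that adding a strand on the right is `cons`. -/
inductive Dir : Type
  | u : Dir
  | d : Dir

open Dir

/-- Oriented tangle diagrams in a rectangle, read from bottom to top, with bottom boundary word
`a` and top boundary word `b`. They are built from identities, stacking (`comp x y`: `x` below,
`y` on top), adding a through string on the right (`whisk`), the cups and caps, and the crossings
of two upward strands. The argument `w` of an elementary diagram lists the vertical through
strings to its left. All other crossings are rotations of the ones between upward strands.
Diagrams that are planar isotopic are identified below. -/
inductive Diag : List Dir → List Dir → Type
  | id (a : List Dir) : Diag a a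
  | comp {a b c : List Dir} (x : Diag a b) (y : Diag b c) : Diag a c
  | whisk (s : Dir) {a b : List Dir} (x : Diag a b) : Diag (s :: a) (s :: b)
  | cupUD (w : List Dir) : Diag w (u :: d :: w)
  | cupDU (w : List Dir) : Diag w (d :: u :: w)
  | capUD (w : List Dir) : Diag (u :: d :: w) w
  | capDU (w : List Dir) : Diag (d :: u :: w) w
  /-- `cross true` is the positive crossing, `cross false` the negative crossing. -/
  | cross (ε : Bool) (w : List Dir) : Diag (u :: u :: w) (u :: u :: w)

namespace Diag

/-- A crossing rotated by a quarter turn. -/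
def rotA (ε : Bool) (w : List Dir) : Diag (d :: u :: w) (u :: d :: w) :=
  ((whisk d (whisk u (cupUD w))).comp (whisk d (cross ε (d :: w)))).comp (capDU (u :: d :: w))

/-- A crossing rotated by a quarter turn in the other sense. -/
def rotB (ε : Bool) (w : List Dir) : Diag (u :: d :: w) (d :: u :: w) :=
  ((cupDU (u :: d :: w)).comp (whisk d (cross ε (d :: w)))).comp (whisk d (whisk u (capUD w)))

/-- A crossing rotated by a half turn. -/
def halfA (ε : Bool) (w : List Dir) : Diag (d :: d :: w) (d :: d :: w) :=
  ((whisk d (whisk d (cupUD w))).comp (whisk d (whisk d (whisk u (cupUD (d :: w)))))).comp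
    ((whisk d (whisk d (cross ε (d :: d :: w)))).comp
      ((whisk d (capDU (u :: d :: d :: w))).comp (capDU (d :: d :: w))))

/-- A crossing rotated by a half turn in the other sense. -/
def halfB (ε : Bool) (w : List Dir) : Diag (d :: d :: w) (d :: d :: w) :=
  ((cupDU (d :: d :: w)).comp (whisk d (cupDU (u :: d :: d :: w)))).comp
    ((whisk d (whisk d (cross ε (d :: d :: w)))).comp
      ((whisk d (whisk d (whisk u (capUD (d :: w))))).comp (whisk d (whisk d (capUD w)))))

/-- An upward strand with a curl, whose loop lies to the left of the strand. -/
def curlL (ε : Bool) (w : List Dir) : Diag (u :: w) (u :: w) :=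
  ((whisk u (cupUD w)).comp (cross ε (d :: w))).comp (whisk u (capUD w))

/-- An upward strand with a curl, whose loop lies to the right of the strand. -/
def curlR (ε : Bool) (w : List Dir) : Diag (u :: w) (u :: w) :=
  ((cupDU (u :: w)).comp (whisk d (cross ε w))).comp (capDU (u :: w))

end Diag

open Diag

/-- The local moves which identify two diagrams: planar isotopy and the oriented
Reidemeister moves II and III. -/
inductive Move : ∀ {a b : List Dir}, Diag a b → Diag a b → Prop
  -- stacking and juxtaposition
  | id_comp {a b : List Dir} (x : Diag a b) : Move ((Diag.id a).comp x) x
  | comp_id {a b : List Dir} (x : Diag a b) : Move (x.comp (Diag.id b)) x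
  | assoc {a b c e : List Dir} (x : Diag a b) (y : Diag b c) (z : Diag c e) :
      Move ((x.comp y).comp z) (x.comp (y.comp z))
  | whisk_id (s : Dir) (a : List Dir) : Move (whisk s (Diag.id a)) (Diag.id (s :: a))
  | whisk_comp (s : Dir) {a b c : List Dir} (x : Diag a b) (y : Diag b c) :
      Move (whisk s (x.comp y)) ((whisk s x).comp (whisk s y))
  -- planar isotopy: sliding distant pieces past each other vertically
  | slide_cupUD {a b : List Dir} (x : Diag a b) :
      Move ((cupUD a).comp (whisk u (whisk d x))) (x.comp (cupUD b))
  | slide_cupDU {a b : List Dir} (x : Diag a b) :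
      Move ((cupDU a).comp (whisk d (whisk u x))) (x.comp (cupDU b))
  | slide_capUD {a b : List Dir} (x : Diag a b) :
      Move ((capUD a).comp x) ((whisk u (whisk d x)).comp (capUD b))
  | slide_capDU {a b : List Dir} (x : Diag a b) :
      Move ((capDU a).comp x) ((whisk d (whisk u x)).comp (capDU b))
  | slide_cross (ε : Bool) {a b : List Dir} (x : Diag a b) :
      Move ((cross ε a).comp (whisk u (whisk u x))) ((whisk u (whisk u x)).comp (cross ε b))
  -- planar isotopy: straightening zigzags
  | zigzag_u (w : List Dir) :
      Move ((whisk u (cupDU w)).comp (capUD (u :: w))) (Diag.id (u :: w))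
  | zigzag_u' (w : List Dir) :
      Move ((cupUD (u :: w)).comp (whisk u (capDU w))) (Diag.id (u :: w))
  | zigzag_d (w : List Dir) :
      Move ((whisk d (cupUD w)).comp (capDU (d :: w))) (Diag.id (d :: w))
  | zigzag_d' (w : List Dir) :
      Move ((cupDU (d :: w)).comp (whisk d (capUD w))) (Diag.id (d :: w))
  -- planar isotopy: a full turn of a crossing is trivial
  | turn (ε : Bool) (w : List Dir) : Move (halfA ε w) (halfB ε w)
  -- Reidemeister II for parallel and for antiparallel strands
  | reidemeister2 (ε : Bool) (w : List Dir) :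
      Move ((cross ε w).comp (cross (!ε) w)) (Diag.id (u :: u :: w))
  | reidemeister2_du (ε : Bool) (w : List Dir) :
      Move ((rotA ε w).comp (rotB (!ε) w)) (Diag.id (d :: u :: w))
  | reidemeister2_ud (ε : Bool) (w : List Dir) :
      Move ((rotB ε w).comp (rotA (!ε) w)) (Diag.id (u :: d :: w))
  -- Reidemeister III
  | reidemeister3 (ε : Bool) (w : List Dir) :
      Move (((cross ε (u :: w)).comp (whisk u (cross ε w))).comp (cross ε (u :: w)))
        (((whisk u (cross ε w)).comp (cross ε (u :: w))).comp (whisk u (cross ε w)))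

noncomputable section Skein

variable {K : Type*} [Field K]

/-- The linear combinations of diagrams which vanish by a single application of a local
relation: planar isotopy, Reidemeister II and III, the Hecke relation, Reidemeister I and the
values of the two circles, each of them applied anywhere inside a larger diagram. -/
inductive Rel (q r δ : K) : ∀ {a b : List Dir}, (Diag a b →₀ K) → Prop
  | move {a b : List Dir} {x y : Diag a b} (h : Move x y) :
      Rel q r δ (Finsupp.single x 1 - Finsupp.single y 1)
  | hecke (w : List Dir) :
      Rel q r δ (Finsupp.single (cross true w) 1 - Finsupp.single (cross false w) 1
        - Finsupp.single (Diag.id (u :: u :: w)) (q - q⁻¹))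
  | curlL_pos (w : List Dir) :
      Rel q r δ (Finsupp.single (curlL true w) 1 - Finsupp.single (Diag.id (u :: w)) r)
  | curlL_neg (w : List Dir) :
      Rel q r δ (Finsupp.single (curlL false w) 1 - Finsupp.single (Diag.id (u :: w)) r⁻¹)
  | curlR_pos (w : List Dir) :
      Rel q r δ (Finsupp.single (curlR true w) 1 - Finsupp.single (Diag.id (u :: w)) r)
  | curlR_neg (w : List Dir) :
      Rel q r δ (Finsupp.single (curlR false w) 1 - Finsupp.single (Diag.id (u :: w)) r⁻¹)
  | circleUD (w : List Dir) :
      Rel q r δ (Finsupp.single ((cupUD w).comp (capUD w)) 1 - Finsupp.single (Diag.id w) δ)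
  | circleDU (w : List Dir) :
      Rel q r δ (Finsupp.single ((cupDU w).comp (capDU w)) 1 - Finsupp.single (Diag.id w) δ)
  | comp_left {a b c : List Dir} (x : Diag a b) {y : Diag b c →₀ K} (h : Rel q r δ y) :
      Rel q r δ (Finsupp.lmapDomain K K (fun z => x.comp z) y)
  | comp_right {a b c : List Dir} {x : Diag a b →₀ K} (y : Diag b c) (h : Rel q r δ x) :
      Rel q r δ (Finsupp.lmapDomain K K (fun z => z.comp y) x)
  | whisk (s : Dir) {a b : List Dir} {x : Diag a b →₀ K} (h : Rel q r δ x) :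
      Rel q r δ (Finsupp.lmapDomain K K (fun z => Diag.whisk s z) x)

/-- The span of all relations. -/
def relations (q r δ : K) (a b : List Dir) : Submodule K (Diag a b →₀ K) :=
  Submodule.span K {x | Rel q r δ x}

/-- The HOMFLY-PT skein module: linear combinations of oriented tangle diagrams from `a` to `b`
modulo planar isotopy and the HOMFLY-PT relations with parameters `q`, `r` and circle
parameter `δ`. -/
def Skein (q r δ : K) (a b : List Dir) : Type _ :=
  (Diag a b →₀ K) ⧸ relations q r δ a b

variable {q r δ : K} {a b c : List Dir}

instance : AddCommGroup (Skein q r δ a b) :=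
  inferInstanceAs (AddCommGroup ((Diag a b →₀ K) ⧸ relations q r δ a b))

instance : Module K (Skein q r δ a b) :=
  inferInstanceAs (Module K ((Diag a b →₀ K) ⧸ relations q r δ a b))

variable (q r δ) in
/-- The class of a diagram in the skein module. -/
def Diag.toSkein (x : Diag a b) : Skein q r δ a b :=
  (relations q r δ a b).mkQ (Finsupp.single x 1)

theorem lmapDomain_mem_relations {a' b' : List Dir} (f : Diag a b → Diag a' b')
    (hf : ∀ x : Diag a b →₀ K, Rel q r δ x → Rel q r δ (Finsupp.lmapDomain K K f x)) :
    relations q r δ a b ≤ (relations q r δ a' b').comap (Finsupp.lmapDomain K K f) := by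
  refine Submodule.span_le.2 fun x hx => ?_
  exact Submodule.subset_span (hf x hx)

/-- The bilinear extension of stacking to linear combinations of diagrams. -/
def linComp : (Diag a b →₀ K) →ₗ[K] (Diag b c →₀ K) →ₗ[K] (Diag a c →₀ K) :=
  Finsupp.linearCombination K fun x => Finsupp.lmapDomain K K fun y => Diag.comp x y

theorem linComp_single_right (x : Diag a b →₀ K) (y : Diag b c) (t : K) :
    linComp x (Finsupp.single y t) = t • Finsupp.lmapDomain K K (fun z => Diag.comp z y) x := by
  induction x using Finsupp.induction_linear with
  | zero => simp
  | add f g hf hg => simp only [map_add, LinearMap.add_apply, hf, hg, smul_add]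
  | single x s => simp [linComp, Finsupp.linearCombination_single, mul_comm]

theorem linComp_mem_right (x : Diag a b →₀ K) {y : Diag b c →₀ K}
    (hy : y ∈ relations q r δ b c) : linComp x y ∈ relations q r δ a c := by
  induction x using Finsupp.induction_linear with
  | zero => simp
  | add f g hf hg =>
    rw [map_add, LinearMap.add_apply]
    exact Submodule.add_mem _ hf hg
  | single x s =>
    rw [linComp, Finsupp.linearCombination_single, LinearMap.smul_apply]
    exact Submodule.smul_mem _ _
      (lmapDomain_mem_relations _ (fun _ h => Rel.comp_left x h) hy)

theorem linComp_mem_left {x : Diag a b →₀ K} (y : Diag b c →₀ K)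
    (hx : x ∈ relations q r δ a b) : linComp x y ∈ relations q r δ a c := by
  induction y using Finsupp.induction_linear with
  | zero => simp
  | add f g hf hg =>
    rw [map_add]
    exact Submodule.add_mem _ hf hg
  | single y t =>
    rw [linComp_single_right]
    exact Submodule.smul_mem _ _
      (lmapDomain_mem_relations _ (fun _ h => Rel.comp_right y h) hx)

namespace Skein

/-- Stacking, as a bilinear operation on skeins: `comp x y` has `x` below and `y` on top. -/
def comp : Skein q r δ a b →ₗ[K] Skein q r δ b c →ₗ[K] Skein q r δ a c :=
  (relations q r δ a b).liftQ
    (LinearMap.mk₂ K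
      (fun x y => (relations q r δ b c).mapQ (relations q r δ a c) (linComp x)
        (fun _ hy => linComp_mem_right x hy) y)
      (fun x x' y => by
        obtain ⟨y, rfl⟩ := Submodule.mkQ_surjective _ y
        simp only [map_add, LinearMap.add_apply, Submodule.mkQ_apply, Submodule.mapQ_apply]
        rfl)
      (fun t x y => by
        obtain ⟨y, rfl⟩ := Submodule.mkQ_surjective _ y
        simp only [map_smul, LinearMap.smul_apply, Submodule.mkQ_apply, Submodule.mapQ_apply]
        rfl)
      (fun x y y' => map_add _ y y')
      (fun t x y => map_smul _ t y))
    (fun x hx => by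
      refine LinearMap.ext fun y => ?_
      obtain ⟨y, rfl⟩ := Submodule.mkQ_surjective _ y
      exact (Submodule.Quotient.mk_eq_zero _).2 (linComp_mem_left y hx))

theorem comp_toSkein (x : Diag a b) (y : Diag b c) :
    comp (x.toSkein q r δ) (y.toSkein q r δ) = (x.comp y).toSkein q r δ := by
  change (relations q r δ a c).mkQ (linComp (Finsupp.single x 1) (Finsupp.single y 1)) = _
  rw [linComp_single_right]
  simp [Diag.toSkein]

/-- Adding a through string on the right, as a linear operation on skeins. -/
def whisk (s : Dir) : Skein q r δ a b →ₗ[K] Skein q r δ (s :: a) (s :: b) :=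
  (relations q r δ a b).mapQ (relations q r δ (s :: a) (s :: b))
    (Finsupp.lmapDomain K K fun x => Diag.whisk s x)
    (lmapDomain_mem_relations _ fun _ h => Rel.whisk s h)

theorem whisk_toSkein (s : Dir) (x : Diag a b) :
    whisk s (x.toSkein q r δ) = (x.whisk s).toSkein q r δ := by
  change (relations q r δ (s :: a) (s :: b)).mkQ (Finsupp.lmapDomain K K _ _) = _
  simp [Diag.toSkein]

/-- The identity skein consists of vertical strings. -/
instance : One (Skein q r δ a a) := ⟨(Diag.id a).toSkein q r δ⟩

/-- The product of skeins with equal bottom and top boundary is stacking. -/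
instance : Mul (Skein q r δ a a) := ⟨fun x y => comp x y⟩

/-- Closing the rightmost strand, which is oriented upwards, around the right. -/
def closeU (x : Skein q r δ (u :: a) (u :: b)) : Skein q r δ a b :=
  comp (comp ((cupDU a).toSkein q r δ) (whisk d x)) ((capDU b).toSkein q r δ)

/-- Closing the rightmost strand, which is oriented downwards, around the right. -/
def closeD (x : Skein q r δ (d :: a) (d :: b)) : Skein q r δ a b :=
  comp (comp ((cupUD a).toSkein q r δ) (whisk u x)) ((capUD b).toSkein q r δ)

end Skein

end Skein

noncomputable section Box

variable {K : Type*} [Field K]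

/-- The space of closed diagrams of the HOMFLY-PT planar algebra. Its unit `1` is the empty
diagram. -/
abbrev Box0 (q r δ : K) : Type _ := Skein q r δ [] []

/-- The `3`-box space of the HOMFLY-PT planar algebra: six boundary points, with alternating
orientations around the boundary of the rectangle. -/
abbrev Box3 (q r δ : K) : Type _ := Skein q r δ [u, d, u] [u, d, u]

variable {q r δ : K}

/-- The closure of a `3`-box: all three strands are closed around the right. -/
def closure (x : Box3 q r δ) : Box0 q r δ :=
  Skein.closeU (Skein.closeD (Skein.closeU x))

/-- The Markov trace of the `3`-box `x` is the scalar `t`: the closure of `x` is `t` times the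
empty diagram. -/
def HasTrace (x : Box3 q r δ) (t : K) : Prop :=
  closure x = t • (1 : Box0 q r δ)

variable (q r δ)

/-- The Temperley-Lieb generator: cap and cup on the two rightmost strands. -/
def tl₁ : Box3 q r δ := ((capUD [u]).comp (cupUD [u])).toSkein q r δ

/-- The Temperley-Lieb generator: cap and cup on the two leftmost strands. -/
def tl₂ : Box3 q r δ := (whisk u ((capDU []).comp (cupDU []))).toSkein q r δ

/-- The third Jones-Wenzl idempotent `f₃`, for `δ ^ 2 ≠ 1`: the Temperley-Lieb element with
coefficient `1` at the identity which is annihilated by all caps and cups. -/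
def jonesWenzl₃ : Box3 q r δ :=
  1 - (δ / (δ ^ 2 - 1)) • (tl₁ q r δ + tl₂ q r δ)
    + (1 / (δ ^ 2 - 1)) • (tl₁ q r δ * tl₂ q r δ + tl₂ q r δ * tl₁ q r δ)

end Box

end HOMFLY

/-! Let `x` be the crossing of the two upward strands of a `3`-box, conjugated by antiparallel
crossings with the middle strand (`crossOuter`). By Reidemeister II it inherits the Hecke relation
`x² = (q - q⁻¹)x + 1`, so its eigenvalues are `q` and `-q⁻¹`, and `(q - x)/(q + q⁻¹)` and `(x +
q⁻¹)/(q + q⁻¹)` are complementary idempotents.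

The element `x` sends each Temperley-Lieb cap to a combination of caps (`crossOuter_comp_cap₁`,
`crossOuter_comp_cap₂`). The Jones-Wenzl idempotent `f` kills caps, hence `f * x * f = f * x`.
Multiplying the two spectral idempotents by `f` on the left therefore keeps them idempotent, and the
products add up to `f`.

The traces are linear combinations of `tr f = δ³ - 2δ` and `tr (f x) = rδ² - (q - q⁻¹)δ`;
substituting the value of `δ` makes them factor. -/

namespace HOMFLY

open Dir Diag

/-! ### Skeins as a linear category. -/

noncomputable section SkeinCalculus

variable {K : Type*} [Field K] {q r δ : K} {a b c e : List Dir}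

local notation "sk" => Diag.toSkein q r δ
local notation:80 x:81 " ⊳ " y:80 => Skein.comp x y

namespace Skein

theorem toSkein_eq_of_move {x y : Diag a b} (h : Move x y) : sk x = sk y := by
  refine (Submodule.Quotient.eq _).2 ?_
  exact Submodule.subset_span (Rel.move h)

/-- Classes of diagrams span the skein module. -/
theorem induction {p : Skein q r δ a b → Prop} (zero : p 0)
    (add : ∀ x y, p x → p y → p (x + y)) (smul : ∀ (t : K) (x : Diag a b), p (t • sk x))
    (x : Skein q r δ a b) : p x := by
  obtain ⟨x, rfl⟩ := Submodule.mkQ_surjective _ x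
  induction x using Finsupp.induction_linear with
  | zero => exact zero
  | add f g hf hg => rw [map_add]; exact add _ _ hf hg
  | single x t =>
    have h : (Finsupp.single x t : Diag a b →₀ K) = t • Finsupp.single x 1 := by simp
    rw [h, map_smul]
    exact smul t x

/-- Linear maps on a skein module which agree on diagrams are equal. -/
theorem linearMap_ext {M : Type*} [AddCommGroup M] [Module K M] {f g : Skein q r δ a b →ₗ[K] M}
    (h : ∀ x : Diag a b, f (sk x) = g (sk x)) : f = g := by
  ext x
  induction x using Skein.induction with
  | zero => simp
  | add x y hx hy => simp [hx, hy]
  | smul t x => simp [h]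

theorem one_def : (1 : Skein q r δ a a) = sk (Diag.id a) := rfl

theorem mul_def (x y : Skein q r δ a a) : x * y = x ⊳ y := rfl

theorem one_comp (x : Skein q r δ a b) : (1 : Skein q r δ a a) ⊳ x = x := by
  have h : Skein.comp (1 : Skein q r δ a a) = (LinearMap.id : _ →ₗ[K] Skein q r δ a b) :=
    linearMap_ext fun x => by
      rw [one_def, comp_toSkein]; exact toSkein_eq_of_move (Move.id_comp x)
  exact LinearMap.congr_fun h x

theorem comp_one (x : Skein q r δ a b) : x ⊳ (1 : Skein q r δ b b) = x := by
  have h : Skein.comp.flip (1 : Skein q r δ b b) = (LinearMap.id : _ →ₗ[K] Skein q r δ a b) :=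
    linearMap_ext fun x => by
      rw [LinearMap.flip_apply, one_def, comp_toSkein]
      exact toSkein_eq_of_move (Move.comp_id x)
  exact LinearMap.congr_fun h x

theorem comp_assoc (x : Skein q r δ a b) (y : Skein q r δ b c) (z : Skein q r δ c e) :
    (x ⊳ y) ⊳ z = x ⊳ y ⊳ z := by
  induction x using Skein.induction with
  | zero => simp
  | add x x' hx hx' => simp [hx, hx']
  | smul t x =>
    induction y using Skein.induction with
    | zero => simp
    | add y y' hy hy' => simp only [map_add, LinearMap.add_apply, hy, hy']
    | smul s y =>
      induction z using Skein.induction with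
      | zero => simp
      | add z z' hz hz' => simp only [map_add, hz, hz']
      | smul v z =>
        simp only [map_smul, LinearMap.smul_apply, comp_toSkein,
          toSkein_eq_of_move (Move.assoc x y z)]

theorem whisk_comp (s : Dir) (x : Skein q r δ a b) (y : Skein q r δ b c) :
    whisk s (x ⊳ y) = whisk s x ⊳ whisk s y := by
  induction x using Skein.induction with
  | zero => simp
  | add x x' hx hx' => simp [hx, hx']
  | smul t x =>
    induction y using Skein.induction with
    | zero => simp
    | add y y' hy hy' => simp only [map_add, hy, hy']
    | smul v y =>
      simp only [map_smul, LinearMap.smul_apply, comp_toSkein, whisk_toSkein,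
        toSkein_eq_of_move (Move.whisk_comp s x y)]

theorem whisk_one (s : Dir) (a : List Dir) :
    whisk s (1 : Skein q r δ a a) = 1 := by
  rw [one_def, whisk_toSkein]; exact toSkein_eq_of_move (Move.whisk_id s a)

/-- An equation between composites, followed by a further skein. -/
theorem reassoc {x : Skein q r δ a b} {y : Skein q r δ b c} {z : Skein q r δ a c}
    (h : x ⊳ y = z) (t : Skein q r δ c e) : x ⊳ y ⊳ t = z ⊳ t := by
  rw [← comp_assoc, h]

/-- The product and the scalars make the endomorphism skeins of a word an algebra. -/
scoped instance : Ring (Skein q r δ a a) :=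
  { (inferInstance : AddCommGroup (Skein q r δ a a)),
    (inferInstance : One (Skein q r δ a a)),
    (inferInstance : Mul (Skein q r δ a a)) with
    left_distrib := fun x y z => map_add (Skein.comp x) y z
    right_distrib := fun x y z => by simp only [mul_def, map_add, LinearMap.add_apply]
    zero_mul := fun x => by simp only [mul_def, map_zero, LinearMap.zero_apply]
    mul_zero := fun x => map_zero (Skein.comp x)
    mul_assoc := comp_assoc
    one_mul := one_comp
    mul_one := comp_one }

scoped instance : Algebra K (Skein q r δ a a) :=
  Algebra.ofModule (fun t x y => by simp only [mul_def, map_smul, LinearMap.smul_apply])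
    (fun t x y => by simp only [mul_def, map_smul])

/-! ### Elementary skeins, isotopies and the local relations. -/

variable (q r δ) in
/-- The cup `u d`. -/
abbrev cupUD (w : List Dir) : Skein q r δ w (u :: d :: w) := sk (Diag.cupUD w)

variable (q r δ) in
/-- The cup `d u`. -/
abbrev cupDU (w : List Dir) : Skein q r δ w (d :: u :: w) := sk (Diag.cupDU w)

variable (q r δ) in
/-- The cap `u d`. -/
abbrev capUD (w : List Dir) : Skein q r δ (u :: d :: w) w := sk (Diag.capUD w)

variable (q r δ) in
/-- The cap `d u`. -/
abbrev capDU (w : List Dir) : Skein q r δ (d :: u :: w) w := sk (Diag.capDU w)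

variable (q r δ) in
/-- The crossing of two upward strands. -/
abbrev cross (ε : Bool) (w : List Dir) : Skein q r δ (u :: u :: w) (u :: u :: w) :=
  sk (Diag.cross ε w)

theorem slide_cupUD (x : Skein q r δ a b) :
    cupUD q r δ a ⊳ whisk u (whisk d x) = x ⊳ cupUD q r δ b := by
  induction x using Skein.induction with
  | zero => simp
  | add x x' hx hx' => simp [hx, hx']
  | smul t x =>
    simp only [map_smul, LinearMap.smul_apply, comp_toSkein, whisk_toSkein,
      toSkein_eq_of_move (Move.slide_cupUD x)]

theorem slide_cupDU (x : Skein q r δ a b) :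
    cupDU q r δ a ⊳ whisk d (whisk u x) = x ⊳ cupDU q r δ b := by
  induction x using Skein.induction with
  | zero => simp
  | add x x' hx hx' => simp [hx, hx']
  | smul t x =>
    simp only [map_smul, LinearMap.smul_apply, comp_toSkein, whisk_toSkein,
      toSkein_eq_of_move (Move.slide_cupDU x)]

theorem slide_capUD (x : Skein q r δ a b) :
    capUD q r δ a ⊳ x = whisk u (whisk d x) ⊳ capUD q r δ b := by
  induction x using Skein.induction with
  | zero => simp
  | add x x' hx hx' => simp [hx, hx']
  | smul t x =>
    simp only [map_smul, LinearMap.smul_apply, comp_toSkein, whisk_toSkein,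
      toSkein_eq_of_move (Move.slide_capUD x)]

theorem slide_capDU (x : Skein q r δ a b) :
    capDU q r δ a ⊳ x = whisk d (whisk u x) ⊳ capDU q r δ b := by
  induction x using Skein.induction with
  | zero => simp
  | add x x' hx hx' => simp [hx, hx']
  | smul t x =>
    simp only [map_smul, LinearMap.smul_apply, comp_toSkein, whisk_toSkein,
      toSkein_eq_of_move (Move.slide_capDU x)]

variable (w : List Dir) (ε : Bool)

theorem zigzag_u : whisk u (cupDU q r δ w) ⊳ capUD q r δ (u :: w) = 1 := by
  rw [whisk_toSkein, comp_toSkein]; exact toSkein_eq_of_move (Move.zigzag_u w)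

theorem zigzag_u' : cupUD q r δ (u :: w) ⊳ whisk u (capDU q r δ w) = 1 := by
  rw [whisk_toSkein, comp_toSkein]; exact toSkein_eq_of_move (Move.zigzag_u' w)

theorem zigzag_d : whisk d (cupUD q r δ w) ⊳ capDU q r δ (d :: w) = 1 := by
  rw [whisk_toSkein, comp_toSkein]; exact toSkein_eq_of_move (Move.zigzag_d w)

theorem zigzag_d' : cupDU q r δ (d :: w) ⊳ whisk d (capUD q r δ w) = 1 := by
  rw [whisk_toSkein, comp_toSkein]; exact toSkein_eq_of_move (Move.zigzag_d' w)

theorem circleUD : cupUD q r δ w ⊳ capUD q r δ w = δ • 1 := by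
  rw [comp_toSkein, one_def, ← sub_eq_zero]
  have h : (Finsupp.single (Diag.id w) δ : Diag w w →₀ K) = δ • Finsupp.single (Diag.id w) 1 := by
    simp
  have := (Submodule.Quotient.mk_eq_zero (relations q r δ w w)).2
    (Submodule.subset_span (Rel.circleUD w))
  rw [h] at this
  exact this

theorem circleDU : cupDU q r δ w ⊳ capDU q r δ w = δ • 1 := by
  rw [comp_toSkein, one_def, ← sub_eq_zero]
  have h : (Finsupp.single (Diag.id w) δ : Diag w w →₀ K) = δ • Finsupp.single (Diag.id w) 1 := by
    simp
  have := (Submodule.Quotient.mk_eq_zero (relations q r δ w w)).2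
    (Submodule.subset_span (Rel.circleDU w))
  rw [h] at this
  exact this

theorem cross_true_eq : cross q r δ true w = cross q r δ false w + (q - q⁻¹) • 1 := by
  rw [one_def, ← sub_eq_zero, ← sub_sub]
  have h : (Finsupp.single (Diag.id (u :: u :: w)) (q - q⁻¹) : _ →₀ K)
      = (q - q⁻¹) • Finsupp.single (Diag.id (u :: u :: w)) 1 := by
    simp
  have := (Submodule.Quotient.mk_eq_zero (relations q r δ _ _)).2
    (Submodule.subset_span (Rel.hecke w))
  rw [h] at this
  exact this

/-- The framing factor of a curl. -/
def framing (r : K) (ε : Bool) : K := bif ε then r else r⁻¹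

theorem curlL_eq : (whisk u (cupUD q r δ w) ⊳ cross q r δ ε (d :: w)) ⊳ whisk u (capUD q r δ w)
    = framing r ε • 1 := by
  have h (t : K) : (Finsupp.single (Diag.id (u :: w)) t : _ →₀ K)
      = t • Finsupp.single (Diag.id (u :: w)) 1 := by
    simp
  simp only [comp_toSkein, whisk_toSkein]
  rw [one_def, ← sub_eq_zero]
  cases ε
  · have := (Submodule.Quotient.mk_eq_zero (relations q r δ _ _)).2
      (Submodule.subset_span (Rel.curlL_neg w))
    rw [h] at this
    exact this
  · have := (Submodule.Quotient.mk_eq_zero (relations q r δ _ _)).2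
      (Submodule.subset_span (Rel.curlL_pos w))
    rw [h] at this
    exact this

theorem curlR_eq : (cupDU q r δ (u :: w) ⊳ whisk d (cross q r δ ε w)) ⊳ capDU q r δ (u :: w)
    = framing r ε • 1 := by
  have h (t : K) : (Finsupp.single (Diag.id (u :: w)) t : _ →₀ K)
      = t • Finsupp.single (Diag.id (u :: w)) 1 := by
    simp
  simp only [comp_toSkein, whisk_toSkein]
  rw [one_def, ← sub_eq_zero]
  cases ε
  · have := (Submodule.Quotient.mk_eq_zero (relations q r δ _ _)).2
      (Submodule.subset_span (Rel.curlR_neg w))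
    rw [h] at this
    exact this
  · have := (Submodule.Quotient.mk_eq_zero (relations q r δ _ _)).2
      (Submodule.subset_span (Rel.curlR_pos w))
    rw [h] at this
    exact this

variable (q r δ) in
/-- The class of a crossing rotated by a quarter turn. -/
def rotA : Skein q r δ (d :: u :: w) (u :: d :: w) := sk (Diag.rotA ε w)

variable (q r δ) in
/-- The class of a crossing rotated by a quarter turn in the other sense. -/
def rotB : Skein q r δ (u :: d :: w) (d :: u :: w) := sk (Diag.rotB ε w)

theorem rotA_eq : rotA q r δ w ε = whisk d (whisk u (cupUD q r δ w)) ⊳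
    whisk d (cross q r δ ε (d :: w)) ⊳ capDU q r δ (u :: d :: w) := by
  rw [← comp_assoc]; simp only [comp_toSkein, whisk_toSkein]; rfl

theorem rotB_eq : rotB q r δ w ε = cupDU q r δ (u :: d :: w) ⊳
    whisk d (cross q r δ ε (d :: w)) ⊳ whisk d (whisk u (capUD q r δ w)) := by
  rw [← comp_assoc]; simp only [comp_toSkein, whisk_toSkein]; rfl

theorem cross_comp_cross : cross q r δ ε w ⊳ cross q r δ (!ε) w = 1 := by
  rw [comp_toSkein]; exact toSkein_eq_of_move (Move.reidemeister2 ε w)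

theorem rotA_comp_rotB : rotA q r δ w ε ⊳ rotB q r δ w (!ε) = 1 := by
  rw [rotA, rotB, comp_toSkein]; exact toSkein_eq_of_move (Move.reidemeister2_du ε w)

theorem rotB_comp_rotA : rotB q r δ w ε ⊳ rotA q r δ w (!ε) = 1 := by
  rw [rotA, rotB, comp_toSkein]; exact toSkein_eq_of_move (Move.reidemeister2_ud ε w)

/-! Cups and caps absorb a rotated crossing at the cost of a framing factor. -/

/-- Sliding the outer cup past the bends of the rotated crossing leaves a curl: a left one for
`cupUD_comp_rotB` and `rotA_comp_capUD`, a right one for `cupDU_comp_rotA`. -/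
theorem cupUD_comp_rotB :
    cupUD q r δ w ⊳ rotB q r δ w ε = framing r ε • cupDU q r δ w := by
  rw [rotB_eq, reassoc (slide_cupDU (cupUD q r δ w)).symm, comp_assoc, ← whisk_comp, ← whisk_comp,
    ← comp_assoc (whisk u _), curlL_eq, map_smul, map_smul, whisk_one, comp_one]

theorem cupDU_comp_rotA :
    cupDU q r δ w ⊳ rotA q r δ w ε = framing r ε • cupUD q r δ w := by
  rw [rotA_eq, reassoc (slide_cupDU (cupUD q r δ w)), comp_assoc, ← comp_assoc (cupDU q r δ _),
    curlR_eq, map_smul, comp_one]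

theorem rotA_comp_capUD :
    rotA q r δ w ε ⊳ capUD q r δ w = framing r ε • capDU q r δ w := by
  rw [rotA_eq, comp_assoc, comp_assoc, slide_capDU (capUD q r δ w),
    ← comp_assoc (whisk d (cross q r δ ε _)), ← comp_assoc (whisk d _), ← whisk_comp,
    ← whisk_comp, ← comp_assoc (whisk u _), curlL_eq, map_smul, map_smul,
    LinearMap.smul_apply, whisk_one, one_comp]

/-! A cup or cap can be pulled over a crossing, which becomes a rotated one. -/

/-- The contents of `rotA` slide below the cup, which then forms a zigzag with the cap of `rotA` and
is straightened. -/
theorem cupUD_comp_whisk_rotA : cupUD q r δ (u :: w) ⊳ whisk u (rotA q r δ w ε)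
    = whisk u (cupUD q r δ w) ⊳ cross q r δ ε (d :: w) := by
  rw [rotA_eq, whisk_comp, whisk_comp, reassoc (slide_cupUD _), comp_assoc,
    reassoc (slide_cupUD _), comp_assoc, zigzag_u', comp_one]

theorem whisk_rotB_comp_capUD : whisk u (rotB q r δ w ε) ⊳ capUD q r δ (u :: w)
    = cross q r δ ε (d :: w) ⊳ whisk u (capUD q r δ w) := by
  rw [rotB_eq, whisk_comp, whisk_comp, comp_assoc, comp_assoc, ← slide_capUD,
    ← comp_assoc (whisk u (whisk d _)), ← slide_capUD, comp_assoc, reassoc (zigzag_u _), one_comp]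

/-! Partial closures. -/

theorem closeU_whisk (x : Skein q r δ a b) : closeU (whisk u x) = δ • x := by
  rw [closeU, slide_cupDU, comp_assoc, circleDU, map_smul, comp_one]

theorem closeD_whisk (x : Skein q r δ a b) : closeD (whisk d x) = δ • x := by
  rw [closeD, slide_cupUD, comp_assoc, circleUD, map_smul, comp_one]

theorem closeU_capUD_comp (x : Skein q r δ (u :: w) (u :: b)) :
    closeU (capUD q r δ (u :: w) ⊳ x) = whisk d x ⊳ capDU q r δ b := by
  rw [closeU, whisk_comp, reassoc (zigzag_d' _), one_comp]

theorem closeU_comp_cupUD (x : Skein q r δ (u :: a) (u :: w)) :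
    closeU (x ⊳ cupUD q r δ (u :: w)) = cupDU q r δ a ⊳ whisk d x := by
  rw [closeU, whisk_comp, comp_assoc, comp_assoc, zigzag_d, comp_one]

/-- Pieces that do not touch the closed strand slide out of the closure: the partial trace is a
bimodule map. -/
theorem closeU_whisk_comp_whisk (x : Skein q r δ a b) (y : Skein q r δ (u :: b) (u :: c))
    (z : Skein q r δ c e) :
    closeU (whisk u x ⊳ y ⊳ whisk u z) = x ⊳ closeU y ⊳ z := by
  simp only [closeU, whisk_comp, comp_assoc]
  rw [reassoc (slide_cupDU x), comp_assoc, slide_capDU z]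

theorem closeU_cross : closeU (cross q r δ ε w) = framing r ε • 1 := by
  rw [closeU, curlR_eq]

theorem closeD_capDU_comp_cupDU :
    closeD (capDU q r δ w ⊳ cupDU q r δ w) = (1 : Skein q r δ (u :: w) (u :: w)) := by
  rw [closeD, whisk_comp, reassoc (zigzag_u' _), one_comp, zigzag_u]

end Skein

end SkeinCalculus

/-! ### Temperley-Lieb elements and the outer crossing in the `3`-box space. -/

noncomputable section ThreeBox

open Skein

variable {K : Type*} [Field K] {q r δ : K}

local notation:80 x:81 " ⊳ " y:80 => Skein.comp x y

variable (q r δ)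

/-- The cup on the two rightmost strands of a `3`-box. -/
abbrev cup₁ : Skein q r δ [u] [u, d, u] := Skein.cupUD q r δ [u]

/-- The cup on the two leftmost strands of a `3`-box. -/
abbrev cup₂ : Skein q r δ [u] [u, d, u] := Skein.whisk u (Skein.cupDU q r δ [])

/-- The cap on the two rightmost strands of a `3`-box. -/
abbrev cap₁ : Skein q r δ [u, d, u] [u] := Skein.capUD q r δ [u]

/-- The cap on the two leftmost strands of a `3`-box. -/
abbrev cap₂ : Skein q r δ [u, d, u] [u] := Skein.whisk u (Skein.capDU q r δ [])

/-- The crossing of the two upward strands of a `3`-box, conjugated by a crossing with the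
downward strand. -/
def crossOuter : Box3 q r δ :=
  Skein.whisk u (Skein.rotA q r δ [] true) ⊳ Skein.cross q r δ true [d] ⊳
    Skein.whisk u (Skein.rotB q r δ [] false)

theorem tl₁_eq : tl₁ q r δ = cap₁ q r δ ⊳ cup₁ q r δ := by
  rw [tl₁, comp_toSkein]

theorem tl₂_eq : tl₂ q r δ = cap₂ q r δ ⊳ cup₂ q r δ := by
  rw [tl₂, ← whisk_toSkein, ← comp_toSkein, Skein.whisk_comp]

theorem cup₁_comp_cap₁ : cup₁ q r δ ⊳ cap₁ q r δ = δ • 1 := circleUD _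

theorem cup₂_comp_cap₂ : cup₂ q r δ ⊳ cap₂ q r δ = δ • 1 := by
  rw [← Skein.whisk_comp, circleDU, map_smul, Skein.whisk_one]

theorem cup₁_comp_cap₂ : cup₁ q r δ ⊳ cap₂ q r δ = 1 := Skein.zigzag_u' _

theorem cup₂_comp_cap₁ : cup₂ q r δ ⊳ cap₁ q r δ = 1 := Skein.zigzag_u _

theorem tl₁_mul_tl₂ : tl₁ q r δ * tl₂ q r δ = cap₁ q r δ ⊳ cup₂ q r δ := by
  rw [tl₁_eq, tl₂_eq, mul_def, comp_assoc, reassoc (cup₁_comp_cap₂ q r δ), one_comp]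

theorem tl₂_mul_tl₁ : tl₂ q r δ * tl₁ q r δ = cap₂ q r δ ⊳ cup₁ q r δ := by
  rw [tl₁_eq, tl₂_eq, mul_def, comp_assoc, reassoc (cup₂_comp_cap₁ q r δ), one_comp]

theorem cross_comp_self (w : List Dir) :
    Skein.cross q r δ true w ⊳ Skein.cross q r δ true w
      = (q - q⁻¹) • Skein.cross q r δ true w + 1 := by
  -- Only the second factor is made negative, so that it cancels against the first by Reidemeister
  -- II.
  conv_lhs => arg 2; rw [cross_true_eq]
  rw [map_add, map_smul, comp_one, add_comm]
  exact congrArg _ (cross_comp_cross w true)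

theorem whisk_rotA_comp_whisk_rotB :
    Skein.whisk u (Skein.rotA q r δ [] true) ⊳ Skein.whisk u (Skein.rotB q r δ [] false) = 1 := by
  rw [← Skein.whisk_comp]
  exact (congrArg _ (rotA_comp_rotB [] true)).trans (whisk_one _ _)

/-- The conjugating factors are mutually inverse by antiparallel Reidemeister II, so the quadratic
relation of the crossing carries over. -/
theorem crossOuter_mul_self :
    crossOuter q r δ * crossOuter q r δ = (q - q⁻¹) • crossOuter q r δ + 1 := by
  have hBA : Skein.whisk u (Skein.rotB q r δ [] false) ⊳ Skein.whisk u (Skein.rotA q r δ [] true)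
      = 1 := by
    rw [← Skein.whisk_comp]
    exact (congrArg _ (rotB_comp_rotA [] false)).trans (whisk_one _ _)
  simp only [crossOuter, mul_def, comp_assoc]
  rw [reassoc hBA, one_comp, reassoc (cross_comp_self q r δ _), map_add, LinearMap.add_apply,
    one_comp, map_add, whisk_rotA_comp_whisk_rotB, map_smul, LinearMap.smul_apply, map_smul]

/-- The cup absorbs `rotA` for a factor `r`; pulled over the crossing it becomes `cup₁` followed by
a new `rotA`, which cancels `rotB`. -/
theorem cup₂_comp_crossOuter : cup₂ q r δ ⊳ crossOuter q r δ = r • cup₁ q r δ := by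
  have h : cup₂ q r δ ⊳ Skein.whisk u (Skein.rotA q r δ [] true)
      = r • Skein.whisk u (Skein.cupUD q r δ []) := by
    rw [← Skein.whisk_comp, cupDU_comp_rotA, map_smul]; rfl
  rw [crossOuter, reassoc h, map_smul, LinearMap.smul_apply,
    reassoc (cupUD_comp_whisk_rotA [] true).symm, comp_assoc, whisk_rotA_comp_whisk_rotB, comp_one]

/-- Pulling the cup over `rotA` produces a second positive crossing. The Hecke relation for the
square gives the two terms. -/
theorem cup₁_comp_crossOuter :
    cup₁ q r δ ⊳ crossOuter q r δ = (q - q⁻¹) • cup₁ q r δ + r⁻¹ • cup₂ q r δ := by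
  have h : Skein.whisk u (Skein.cupUD q r δ []) ⊳ Skein.whisk u (Skein.rotB q r δ [] false)
      = r⁻¹ • cup₂ q r δ := by
    rw [← Skein.whisk_comp, cupUD_comp_rotB, map_smul]; rfl
  rw [crossOuter, reassoc (cupUD_comp_whisk_rotA [] true), comp_assoc,
    reassoc (cross_comp_self q r δ _), map_add, LinearMap.add_apply, map_add, one_comp, h,
    map_smul, LinearMap.smul_apply, map_smul,
    reassoc (cupUD_comp_whisk_rotA [] true).symm, comp_assoc, whisk_rotA_comp_whisk_rotB, comp_one]

/-- The cap turns `rotB` into a negative crossing, which cancels the positive one. -/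
theorem crossOuter_comp_cap₁ : crossOuter q r δ ⊳ cap₁ q r δ = r • cap₂ q r δ := by
  rw [crossOuter, comp_assoc, comp_assoc, whisk_rotB_comp_capUD,
    reassoc (show _ ⊳ Skein.cross q r δ false [d] = _ from cross_comp_cross [d] true), one_comp,
    ← Skein.whisk_comp, rotA_comp_capUD, map_smul]
  rfl

theorem crossOuter_comp_cap₂ (hr : r ≠ 0) : crossOuter q r δ ⊳ cap₂ q r δ
    = r⁻¹ • cap₁ q r δ + (q - q⁻¹) • cap₂ q r δ := by
  -- No further diagrams are needed: the quadratic relation applied to `cap₁` determines the image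
  -- of `r • cap₂`, and `r` is invertible.
  have h := congrArg (fun x => x ⊳ cap₁ q r δ) (crossOuter_mul_self q r δ)
  simp only [mul_def, comp_assoc, crossOuter_comp_cap₁, map_smul, map_add, LinearMap.add_apply,
    LinearMap.smul_apply, one_comp] at h
  rw [← inv_smul_smul₀ hr (crossOuter q r δ ⊳ cap₂ q r δ), h, smul_add, smul_comm r⁻¹,
    inv_smul_smul₀ hr, add_comm]

/-! Traces. -/

/-- The closure of a `3`-box as a linear map. -/
def closureLinear : Box3 q r δ →ₗ[K] Box0 q r δ where
  toFun := closure
  map_add' x y := by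
    simp only [closure, closeU, closeD, map_add, LinearMap.add_apply]
  map_smul' t x := by
    simp only [closure, closeU, closeD, map_smul, LinearMap.smul_apply, RingHom.id_apply]

theorem hasTrace_iff (x : Box3 q r δ) (t : K) :
    HasTrace x t ↔ closureLinear q r δ x = t • 1 := Iff.rfl

theorem closeU_one (a : List Dir) : closeU (1 : Skein q r δ (u :: a) (u :: a)) = δ • 1 := by
  rw [← whisk_one, closeU_whisk]

theorem closeD_one (a : List Dir) : closeD (1 : Skein q r δ (d :: a) (d :: a)) = δ • 1 := by
  rw [← whisk_one, closeD_whisk]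

theorem closeU_smul {a b : List Dir} (t : K) (x : Skein q r δ (u :: a) (u :: b)) :
    closeU (t • x) = t • closeU x := by
  simp only [closeU, map_smul, LinearMap.smul_apply]

theorem closeD_smul {a b : List Dir} (t : K) (x : Skein q r δ (d :: a) (d :: b)) :
    closeD (t • x) = t • closeD x := by
  simp only [closeD, map_smul, LinearMap.smul_apply]

theorem closure_of_closeU {x : Box3 q r δ} {t : K} (h : closeU x = t • 1) :
    closureLinear q r δ x = (t * δ ^ 2) • 1 := by
  change closeU (closeD (closeU x)) = _
  rw [h, closeD_smul, closeD_one, closeU_smul, closeU_smul, closeU_one, smul_smul, smul_smul,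
    mul_assoc, pow_two]

/-- After one partial closure, every `3`-box needed here is a multiple either of the identity or of
this cap-cup; the latter closes to one circle, the former to two. -/
theorem closure_of_closeU_eq_tl {x : Box3 q r δ} {t : K}
    (h : closeU x = t • (Skein.capDU q r δ [] ⊳ Skein.cupDU q r δ [])) :
    closureLinear q r δ x = (t * δ) • 1 := by
  change closeU (closeD (closeU x)) = _
  rw [h, closeD_smul, closeD_capDU_comp_cupDU, closeU_smul, closeU_one, smul_smul]

theorem closure_one : closureLinear q r δ 1 = δ ^ 3 • 1 := by
  rw [closure_of_closeU q r δ (closeU_one q r δ _), pow_succ' δ 2]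

theorem closure_crossOuter : closureLinear q r δ (crossOuter q r δ) = (r * δ ^ 2) • 1 := by
  refine closure_of_closeU q r δ ?_
  -- The conjugating crossings avoid the rightmost strand, so closing it leaves a curl between them;
  -- once the curl is removed they cancel.
  rw [crossOuter, closeU_whisk_comp_whisk, closeU_cross, map_smul, LinearMap.smul_apply,
    one_comp, map_smul]
  exact congrArg _ (rotA_comp_rotB [] true)

theorem closure_cap₁_cup₁ :
    closureLinear q r δ (cap₁ q r δ ⊳ cup₁ q r δ) = δ ^ 2 • 1 := by
  rw [closure_of_closeU q r δ (t := 1), one_mul]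
  rw [closeU_capUD_comp, zigzag_d, one_smul]

theorem closure_cap₂_cup₂ :
    closureLinear q r δ (cap₂ q r δ ⊳ cup₂ q r δ) = δ ^ 2 • 1 := by
  rw [closure_of_closeU_eq_tl q r δ (t := δ), pow_two]
  rw [← Skein.whisk_comp, closeU_whisk]

theorem closure_cap₁_cup₂ :
    closureLinear q r δ (cap₁ q r δ ⊳ cup₂ q r δ) = δ • 1 := by
  rw [closure_of_closeU_eq_tl q r δ (t := 1), one_mul]
  rw [closeU_capUD_comp, ← slide_capDU, one_smul]

theorem closure_cap₂_cup₁ :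
    closureLinear q r δ (cap₂ q r δ ⊳ cup₁ q r δ) = δ • 1 := by
  rw [closure_of_closeU_eq_tl q r δ (t := 1), one_mul]
  rw [closeU_comp_cupUD, slide_cupDU, one_smul]

/-! The corner cut out by the Jones-Wenzl idempotent. -/

theorem jonesWenzl₃_eq : jonesWenzl₃ q r δ =
    1 - (δ / (δ ^ 2 - 1)) • (cap₁ q r δ ⊳ cup₁ q r δ + cap₂ q r δ ⊳ cup₂ q r δ)
      + (1 / (δ ^ 2 - 1)) • (cap₁ q r δ ⊳ cup₂ q r δ + cap₂ q r δ ⊳ cup₁ q r δ) := by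
  rw [jonesWenzl₃, tl₁_mul_tl₂, tl₂_mul_tl₁, tl₁_eq, tl₂_eq]

variable {q r δ}

theorem jonesWenzl₃_comp_cap₁ (hδ : δ ^ 2 ≠ 1) : jonesWenzl₃ q r δ ⊳ cap₁ q r δ = 0 := by
  have h0 : δ ^ 2 - 1 ≠ 0 := sub_ne_zero.2 hδ
  rw [jonesWenzl₃_eq]
  simp only [map_add, map_sub, map_smul, LinearMap.add_apply, LinearMap.sub_apply,
    LinearMap.smul_apply, one_comp, comp_assoc, cup₁_comp_cap₁, cup₂_comp_cap₁, comp_one]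
  match_scalars <;> field_simp <;> ring

theorem jonesWenzl₃_comp_cap₂ (hδ : δ ^ 2 ≠ 1) : jonesWenzl₃ q r δ ⊳ cap₂ q r δ = 0 := by
  have h0 : δ ^ 2 - 1 ≠ 0 := sub_ne_zero.2 hδ
  rw [jonesWenzl₃_eq]
  simp only [map_add, map_sub, map_smul, LinearMap.add_apply, LinearMap.sub_apply,
    LinearMap.smul_apply, one_comp, comp_assoc, cup₁_comp_cap₂, cup₂_comp_cap₂, comp_one]
  match_scalars <;> field_simp <;> ring

/-- Every term of the idempotent other than the identity begins with a cap. -/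
theorem mul_jonesWenzl₃_of_comp_cap {x : Box3 q r δ} (h₁ : x ⊳ cap₁ q r δ = 0)
    (h₂ : x ⊳ cap₂ q r δ = 0) : x * jonesWenzl₃ q r δ = x := by
  rw [jonesWenzl₃_eq, mul_def]
  simp only [map_add, map_sub, map_smul, reassoc h₁, reassoc h₂, comp_one, map_zero,
    LinearMap.zero_apply, add_zero, smul_zero, sub_zero]

theorem jonesWenzl₃_mul_self (hδ : δ ^ 2 ≠ 1) :
    jonesWenzl₃ q r δ * jonesWenzl₃ q r δ = jonesWenzl₃ q r δ :=
  mul_jonesWenzl₃_of_comp_cap (jonesWenzl₃_comp_cap₁ hδ) (jonesWenzl₃_comp_cap₂ hδ)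

theorem jonesWenzl₃_mul_crossOuter_mul_jonesWenzl₃ (hδ : δ ^ 2 ≠ 1) (hr : r ≠ 0) :
    jonesWenzl₃ q r δ * crossOuter q r δ * jonesWenzl₃ q r δ
      = jonesWenzl₃ q r δ * crossOuter q r δ := by
  apply mul_jonesWenzl₃_of_comp_cap
  · rw [mul_def, comp_assoc, crossOuter_comp_cap₁, map_smul, jonesWenzl₃_comp_cap₂ hδ, smul_zero]
  · rw [mul_def, comp_assoc, crossOuter_comp_cap₂ q r δ hr, map_add, map_smul, map_smul,
      jonesWenzl₃_comp_cap₁ hδ, jonesWenzl₃_comp_cap₂ hδ, smul_zero, smul_zero, add_zero]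

theorem closure_jonesWenzl₃ (hδ : δ ^ 2 ≠ 1) :
    closureLinear q r δ (jonesWenzl₃ q r δ) = (δ ^ 3 - 2 * δ) • 1 := by
  have h0 : δ ^ 2 - 1 ≠ 0 := sub_ne_zero.2 hδ
  rw [jonesWenzl₃_eq]
  simp only [map_add, map_sub, map_smul, closure_one, closure_cap₁_cup₁, closure_cap₂_cup₂,
    closure_cap₁_cup₂, closure_cap₂_cup₁]
  match_scalars
  field_simp
  ring

/-- With the idempotent on the left, the cups of its Temperley-Lieb terms absorb the outer crossing,
so only closures of cap-cup diagrams and of `crossOuter` itself remain. -/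
theorem closure_jonesWenzl₃_mul_crossOuter (hδ : δ ^ 2 ≠ 1) :
    closureLinear q r δ (jonesWenzl₃ q r δ * crossOuter q r δ)
      = (r * δ ^ 2 - (q - q⁻¹) * δ) • 1 := by
  have h0 : δ ^ 2 - 1 ≠ 0 := sub_ne_zero.2 hδ
  rw [jonesWenzl₃_eq, mul_def]
  simp only [map_add, map_sub, map_smul, LinearMap.add_apply, LinearMap.sub_apply,
    LinearMap.smul_apply, one_comp, comp_assoc, cup₁_comp_crossOuter, cup₂_comp_crossOuter,
    closure_crossOuter, closure_cap₁_cup₁, closure_cap₂_cup₂,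
    closure_cap₁_cup₂, closure_cap₂_cup₁]
  match_scalars
  -- The `r⁻¹` contributions cancel, so the identity holds with `q - q⁻¹` and `r⁻¹` as free
  -- variables.
  generalize q - q⁻¹ = z
  generalize r⁻¹ = s
  field_simp
  ring

/-! ### Spectral splitting of the Jones-Wenzl idempotent. -/

theorem isIdempotentElem_mul {A : Type*} [Ring A] {f y : A} (hf : f * y * f = f * y)
    (hy : y * y = y) : IsIdempotentElem (f * y) := by
  rw [IsIdempotentElem, ← mul_assoc, hf, mul_assoc, hy]

/-- The spectral idempotents of an element with eigenvalues `s` and `-t`. -/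
theorem spectral_idempotents {A : Type*} [Ring A] [Algebra K A] {x : A} {s t : K}
    (hst : s + t ≠ 0) (hx : x * x = (s - t) • x + (s * t) • 1) :
    ((s + t)⁻¹ • (s • 1 - x)) * ((s + t)⁻¹ • (s • 1 - x)) = (s + t)⁻¹ • (s • 1 - x) ∧
    ((s + t)⁻¹ • (x + t • 1)) * ((s + t)⁻¹ • (x + t • 1)) = (s + t)⁻¹ • (x + t • 1) := by
  constructor
  · simp only [sub_mul, mul_sub, smul_mul_assoc, mul_smul_comm, one_mul,
      mul_one, hx]
    match_scalars <;> field_simp <;> ring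
  · simp only [add_mul, mul_add, smul_mul_assoc, mul_smul_comm, one_mul,
      mul_one, hx]
    match_scalars <;> field_simp; ring

/-- The third Jones-Wenzl idempotent splits into two idempotents with known traces. -/
theorem exists_idempotents_add_eq_jonesWenzl₃
    (hq : q ≠ 0) (hr : r ≠ 0) (hq1 : q ^ 2 ≠ 1) (hq2 : q ^ 2 ≠ -1)
    (hδ : r - r⁻¹ = δ * (q - q⁻¹)) (hδ1 : δ ^ 2 ≠ 1) :
    ∃ P Q : Box3 q r δ,
      IsIdempotentElem P ∧ IsIdempotentElem Q ∧
      P + Q = jonesWenzl₃ q r δ ∧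
      HasTrace P
        ((r - r⁻¹) * (r * q - r⁻¹ * q⁻¹) * (r * (q ^ 2)⁻¹ - r⁻¹ * q ^ 2) /
          ((q + q⁻¹) * (q - q⁻¹) ^ 3)) ∧
      HasTrace Q
        ((r - r⁻¹) * (r * q ^ 2 - r⁻¹ * (q ^ 2)⁻¹) * (r * q⁻¹ - r⁻¹ * q) /
          ((q + q⁻¹) * (q - q⁻¹) ^ 3)) := by
  have hs : q + q⁻¹ ≠ 0 := by
    intro h
    apply hq2
    field_simp at h
    linear_combination h
  have hz : q - q⁻¹ ≠ 0 := by
    intro h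
    apply hq1
    field_simp at h
    linear_combination h
  have hδ' : δ = (r - r⁻¹) / (q - q⁻¹) := by rw [hδ, mul_div_cancel_right₀ _ hz]
  have hs' : q ^ 2 + 1 ≠ 0 := fun h => hq2 (eq_neg_of_add_eq_zero_left h)
  have hz' : q ^ 2 - 1 ≠ 0 := sub_ne_zero.2 hq1
  -- These forms expose the factors `q² ± 1`, known to be nonzero, when denominators are cleared.
  have es : q + q⁻¹ = (q ^ 2 + 1) / q := by field_simp
  have ez : q - q⁻¹ = (q ^ 2 - 1) / q := by field_simp
  set f := jonesWenzl₃ q r δ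
  set x := crossOuter q r δ
  -- The constant `1` is written as `q * q⁻¹` to exhibit the eigenvalues `q` and `-q⁻¹`.
  have hx : x * x = (q - q⁻¹) • x + (q * q⁻¹) • 1 := by
    rw [mul_inv_cancel₀ hq, one_smul]; exact crossOuter_mul_self q r δ
  have hff : f * f = f := jonesWenzl₃_mul_self hδ1
  have hfxf : f * x * f = f * x := jonesWenzl₃_mul_crossOuter_mul_jonesWenzl₃ hδ1 hr
  obtain ⟨hP, hQ⟩ := spectral_idempotents hs hx
  -- `P` belongs to the eigenvalue `-q⁻¹` and `Q` to `q`. The condition `f * y * f = f * y` is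
  -- linear in `y`, so it suffices to know it for `1` and `x`.
  refine ⟨f * ((q + q⁻¹)⁻¹ • (q • 1 - x)), f * ((q + q⁻¹)⁻¹ • (x + q⁻¹ • 1)),
    isIdempotentElem_mul ?_ hP, isIdempotentElem_mul ?_ hQ, ?_, ?_, ?_⟩
  · simp only [mul_smul_comm, mul_sub, smul_mul_assoc, sub_mul, mul_one, hff, hfxf]
  · simp only [mul_smul_comm, mul_add, smul_mul_assoc, add_mul, mul_one, hff, hfxf]
  · rw [← mul_add, ← smul_add, ← add_assoc, sub_add_cancel, ← add_smul, inv_smul_smul₀ hs, mul_one]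
  · rw [hasTrace_iff]
    simp only [mul_smul_comm, mul_sub, mul_one, map_smul, map_sub]
    rw [closure_jonesWenzl₃ hδ1, closure_jonesWenzl₃_mul_crossOuter hδ1, smul_smul, ← sub_smul,
      smul_smul]
    congr 1
    -- What remains is the factorisation of `q(δ³ - 2δ) - (rδ² - (q - q⁻¹)δ)` over `q + q⁻¹`, as
    -- rational functions of `q` and `r`.
    rw [hδ', es, ez]
    field_simp
    ring
  · rw [hasTrace_iff]
    simp only [mul_smul_comm, mul_add, mul_one, map_smul, map_add]
    rw [closure_jonesWenzl₃ hδ1, closure_jonesWenzl₃_mul_crossOuter hδ1, smul_smul, ← add_smul,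
      smul_smul]
    congr 1
    rw [hδ', es, ez]
    field_simp
    ring

end ThreeBox

end HOMFLY

theorem lemma3p10 {K : Type*} [Field K] (q r δ : K)
    (hq : q ≠ 0) (hr : r ≠ 0) (hq1 : q ^ 2 ≠ 1) (hq2 : q ^ 2 ≠ -1)
    (hδ : r - r⁻¹ = δ * (q - q⁻¹)) (hδ1 : δ ^ 2 ≠ 1) :
    ∃ P Q : HOMFLY.Box3 q r δ,
      IsIdempotentElem P ∧ IsIdempotentElem Q ∧
      P + Q = HOMFLY.jonesWenzl₃ q r δ ∧
      HOMFLY.HasTrace P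
        ((r - r⁻¹) * (r * q - r⁻¹ * q⁻¹) * (r * (q ^ 2)⁻¹ - r⁻¹ * q ^ 2) /
          ((q + q⁻¹) * (q - q⁻¹) ^ 3)) ∧
      HOMFLY.HasTrace Q
        ((r - r⁻¹) * (r * q ^ 2 - r⁻¹ * (q ^ 2)⁻¹) * (r * q⁻¹ - r⁻¹ * q) /
          ((q + q⁻¹) * (q - q⁻¹) ^ 3)) := by
  exact HOMFLY.exists_idempotents_add_eq_jonesWenzl₃ hq hr hq1 hq2 hδ hδ1
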